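/- There is a constant $C>0$ such that for all integers $n\ge 2$ and $k\ge 0$ there is a quantum query algorithm in the adjacency matrix model which makes at most $C\,(\sqrt{k}\,n+k^2)$ queries and which, for every simple undirected graph $G$ on $n$ vertices, outputs with probability at least $2/3$ a correct answer: a matching of $G$ of size at least $k$ if one exists, and the statement that there is none otherwise. Here a quantum query algorithm with $T$ queries applies $U_0,O_G,U_1,O_G,\dots,O_G,U_T$ to a fixed initial basis state and then measures in the computational basis, where the $U_i$ are unitary operators that do not depend on $G$ and $O_G$ is the oracle $|\{u,v\}\rangle|q\rangle\mapsto|\{u,v\}\rangle|q\oplus E_G(u,v)\rangle$ (tensored with the identity on a finite-dimensional work register), $\{u,v\}$ ranging over the unordered pairs of distinct vertices, $q\in\{0,1\}$, and $E_G(u,v)=1$ if and only if $\{u,v\}$ is an edge of $G$. In other words, the bounded-error quantum query complexity of finding a matching of size at least $k$, or determining that there is none, is $O(\sqrt{k}\,n+k^2)$. -/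

import Mathlib

/-! ## Quantum query algorithms in the adjacency matrix model -/

/-- The unordered pairs of distinct elements of the vertex set `Fin n`. -/
abbrev VertexPair (n : ℕ) : Type := {e : Sym2 (Fin n) // ¬ e.IsDiag}

open Classical in
/-- The adjacency function of `G` on unordered pairs: `true` exactly on the edges of `G`. -/
noncomputable def adjBit {n : ℕ} (G : SimpleGraph (Fin n)) (e : VertexPair n) : Bool :=
  decide (e.1 ∈ G.edgeSet)

/-- Computational basis: a query register holding a vertex pair, an answer bit, and a work
register with basis `W`. -/
abbrev QueryBasis (n : ℕ) (W : Type) : Type := VertexPair n × Bool × W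

/-- The basis permutation `(e, q, w) ↦ (e, q ⊕ E_G(e), w)`. -/
noncomputable def oracleMap {n : ℕ} {W : Type} (G : SimpleGraph (Fin n)) (b : QueryBasis n W) :
    QueryBasis n W :=
  (b.1, xor b.2.1 (adjBit G b.1), b.2.2)

/-- The query operator of `G`, acting on the query register and the answer bit, and as the identity
on the work register. As `oracleMap G` is an involution, the amplitude of `b` after the query is
the amplitude of `oracleMap G b` before it. -/
noncomputable def applyOracle {n : ℕ} {W : Type} (G : SimpleGraph (Fin n))
    (ψ : QueryBasis n W → ℂ) : QueryBasis n W → ℂ :=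
  fun b => ψ (oracleMap G b)

theorem oracleMap_oracleMap {n : ℕ} {W : Type} (G : SimpleGraph (Fin n)) (b : QueryBasis n W) :
    oracleMap G (oracleMap G b) = b := by
  simp [oracleMap]

/-- On basis states the query operator is `|e⟩|q⟩|w⟩ ↦ |e⟩|q ⊕ E_G(e)⟩|w⟩`. -/
theorem applyOracle_single {n : ℕ} {W : Type} [DecidableEq W] (G : SimpleGraph (Fin n))
    (b : QueryBasis n W) :
    applyOracle G (Pi.single b 1) = Pi.single (oracleMap G b) 1 := by
  funext x
  have h : oracleMap G x = b ↔ x = oracleMap G b :=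
    ⟨fun h => by rw [← h, oracleMap_oracleMap], fun h => by rw [h, oracleMap_oracleMap]⟩
  simp [applyOracle, Pi.single_apply, h]

/-- A quantum query algorithm on graphs with vertex set `Fin n` and outputs in `Out`: a number of
queries, a finite-dimensional work register, an initial basis state, input-independent unitary
operators, and the reading of an output from the result of a final measurement in the computational
basis. Only the unitaries `U 0, …, U queries` are ever applied. -/
structure QuantumQueryAlgorithm (n : ℕ) (Out : Type) where
  /-- The number of oracle calls. -/
  queries : ℕ
  /-- The basis of the work register. -/
  Work : Type
  /-- The work register is finite-dimensional. -/
  fintypeWork : Fintype Work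
  /-- Decidable equality of work basis labels (needed to write the identity matrix). -/
  decidableEqWork : DecidableEq Work
  /-- The initial basis state. -/
  init : QueryBasis n Work
  /-- The unitaries; they do not depend on the input graph. -/
  U : ℕ → Matrix.unitaryGroup (QueryBasis n Work) ℂ
  /-- The output announced on each measurement result. -/
  output : QueryBasis n Work → Out

namespace QuantumQueryAlgorithm

attribute [instance] QuantumQueryAlgorithm.fintypeWork
  QuantumQueryAlgorithm.decidableEqWork

/-- The state `U t · O_G · U (t-1) ⋯ O_G · U 0 |init⟩`, after `t` queries to `G`. -/
noncomputable def state {n : ℕ} {Out : Type} (A : QuantumQueryAlgorithm n Out)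
    (G : SimpleGraph (Fin n)) : ℕ → QueryBasis n A.Work → ℂ
  | 0 => Matrix.mulVec (A.U 0).1 (Pi.single A.init 1)
  | t + 1 => Matrix.mulVec (A.U (t + 1)).1 (applyOracle G (A.state G t))

open Classical in
/-- The probability that, on input `G`, the output of the algorithm lies in `S`. -/
noncomputable def outputProb {n : ℕ} {Out : Type} (A : QuantumQueryAlgorithm n Out)
    (G : SimpleGraph (Fin n)) (S : Set Out) : ℝ :=
  ∑ b : QueryBasis n A.Work, if A.output b ∈ S then ‖A.state G A.queries b‖ ^ 2 else 0

end QuantumQueryAlgorithm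

/-! ## The matching problem -/

/-- `M` is a matching of `G`: a set of edges of `G`, no two of which share an endpoint. -/
def IsEdgeMatching {n : ℕ} (G : SimpleGraph (Fin n)) (M : Finset (Sym2 (Fin n))) : Prop :=
  (∀ e ∈ M, e ∈ G.edgeSet) ∧
    ∀ e ∈ M, ∀ f ∈ M, ∀ v : Fin n, v ∈ e → v ∈ f → e = f

/-- Correct answers to the `k`-matching problem on `G`: a matching of size at least `k`, or `none`
(claiming that there is no such matching) if there is none. -/
def IsCorrectMatchingAnswer {n : ℕ} (G : SimpleGraph (Fin n)) (k : ℕ) :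
    Option (Finset (Sym2 (Fin n))) → Prop
  | some M => IsEdgeMatching G M ∧ k ≤ M.card
  | none => ¬ ∃ M : Finset (Sym2 (Fin n)), IsEdgeMatching G M ∧ k ≤ M.card

/-! A classical adaptive procedure with weighted queries is made quantum. Reading `true` costs `w`
and reading `false` costs `w⁻¹`, so a search among n candidates that stops at the first success
costs about 2√n when w = √n. `QueryTree.exists_algorithm` turns worst-case cost, up to a constant
factor, into a number of quantum queries.

The conversion is catalytic. `exists_catalyst` gives each graph G a vector v_G with ‖v_G‖² equal to
the cost on G; when every vector is queried by its own graph, their Gram matrix drops by exactly 1 -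
[same leaf]. With v_G/√K alongside, one query pays for moving 1/K of the squared amplitude from a
common start state to the leaf state: the Gram matrices before and after agree, so one unitary does
this for all graphs and returns the catalyst. After K queries only the leaf remains. Starting
without the catalyst is an error of norm √(cost/K).

The procedure builds a greedy matching. If it has fewer than k edges, its endpoints form a vertex
cover U with fewer than 2k vertices. All edges inside a known set containing U are kept on record.
By `IsEdgeMatching.exists_augment`, a non-maximum matching can be enlarged by one edge while staying
covered where it was, so at most two of the new edges leave the known set, each from a vertex of U,
and any distinct unknown neighbours serve equally well. Such neighbours are searched for: success
enlarges the matching, failure shows that a vertex of U is dead. As |dead| + |matching| grows each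
round, 2k rounds suffice. They cost O(k√n + k²), within the bound by `nat_mul_sqrt_le`. -/

/-! ## Unitaries from Gram matrices -/

section Gram

variable {ι E : Type*} [NormedAddCommGroup E] [InnerProductSpace ℂ E]

theorem norm_linearCombination_eq_of_inner_eq (a b : ι → E)
    (h : ∀ i j, inner ℂ (a i) (a j) = inner ℂ (b i) (b j)) (c : ι →₀ ℂ) :
    ‖Finsupp.linearCombination ℂ a c‖ = ‖Finsupp.linearCombination ℂ b c‖ := by
  have key : inner ℂ (Finsupp.linearCombination ℂ a c) (Finsupp.linearCombination ℂ a c) =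
      inner ℂ (Finsupp.linearCombination ℂ b c) (Finsupp.linearCombination ℂ b c) := by
    simp only [Finsupp.linearCombination_apply, Finsupp.sum, sum_inner, inner_sum,
      inner_smul_left, inner_smul_right, h]
  rw [inner_self_eq_norm_sq_to_K, inner_self_eq_norm_sq_to_K] at key
  have key' : ‖Finsupp.linearCombination ℂ a c‖ ^ 2 = ‖Finsupp.linearCombination ℂ b c‖ ^ 2 := by
    exact_mod_cast key
  exact (pow_left_inj₀ (norm_nonneg _) (norm_nonneg _) two_ne_zero).1 key'

/-- Equal Gram matrices make Σ cᵢaᵢ ↦ Σ cᵢbᵢ well defined and isometric on the span of `a`; finite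
dimension lets it extend to the whole space. -/
theorem exists_linearIsometry_of_inner_eq [FiniteDimensional ℂ E] (a b : ι → E)
    (h : ∀ i j, inner ℂ (a i) (a j) = inner ℂ (b i) (b j)) :
    ∃ f : E →ₗᵢ[ℂ] E, ∀ i, f (a i) = b i := by
  set A := Finsupp.linearCombination ℂ a with hA
  set B := Finsupp.linearCombination ℂ b with hB
  have hnorm : ∀ c, ‖A c‖ = ‖B c‖ := norm_linearCombination_eq_of_inner_eq a b h
  have hker : LinearMap.ker A ≤ LinearMap.ker B := by
    intro c hc
    rw [LinearMap.mem_ker] at hc ⊢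
    rw [← norm_eq_zero, ← hnorm, hc, norm_zero]
  let f : LinearMap.range A →ₗ[ℂ] E :=
    ((LinearMap.ker A).liftQ B hker).comp A.quotKerEquivRange.symm.toLinearMap
  have hf : ∀ c, f ⟨A c, LinearMap.mem_range_self A c⟩ = B c := by
    intro c
    have : A.quotKerEquivRange.symm ⟨A c, LinearMap.mem_range_self A c⟩ =
        (LinearMap.ker A).mkQ c := by
      rw [LinearEquiv.symm_apply_eq]
      rfl
    simp [f, this]
  let g : LinearMap.range A →ₗᵢ[ℂ] E := ⟨f, by
    rintro ⟨_, c, rfl⟩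
    rw [hf, ← hnorm]
    rfl⟩
  refine ⟨g.extend, fun i => ?_⟩
  have h1 : A (Finsupp.single i 1) = a i := by simp [hA]
  have h2 : B (Finsupp.single i 1) = b i := by simp [hB]
  rw [← h1, ← h2, ← hf]
  exact g.extend_apply ⟨A _, LinearMap.mem_range_self A _⟩

end Gram

/-- Taking the graphs as index set gives a single unitary that works for every input at once. -/
theorem exists_unitaryGroup_mulVec {ι β : Type*} [Fintype β] [DecidableEq β] (f g : ι → β → ℝ)
    (h : ∀ i j, ∑ x, f i x * f j x = ∑ x, g i x * g j x) :
    ∃ U : Matrix.unitaryGroup β ℂ, ∀ i,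
      Matrix.mulVec U.1 (fun x => (f i x : ℂ)) = fun x => (g i x : ℂ) := by
  have hin : ∀ u v : β → ℝ, inner ℂ (WithLp.toLp 2 (fun x => (u x : ℂ)) : EuclideanSpace ℂ β)
      (WithLp.toLp 2 (fun x => (v x : ℂ))) = ((∑ x, u x * v x : ℝ) : ℂ) := by
    intro u v
    simp [PiLp.inner_apply, mul_comm]
  obtain ⟨φ, hφ⟩ := exists_linearIsometry_of_inner_eq
    (fun i => (WithLp.toLp 2 (fun x => (f i x : ℂ)) : EuclideanSpace ℂ β))
    (fun i => WithLp.toLp 2 (fun x => (g i x : ℂ))) (fun i j => by rw [hin, hin, h])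
  let u := Unitary.linearIsometryEquiv.symm (φ.toLinearIsometryEquiv rfl)
  refine ⟨⟨(Matrix.toEuclideanCLM (n := β) (𝕜 := ℂ)).symm u.1, ?_⟩, fun i => ?_⟩
  · exact Unitary.map_mem (Matrix.toEuclideanCLM (n := β) (𝕜 := ℂ)).symm u.2
  · rw [← Matrix.ofLp_toEuclideanCLM _ (WithLp.toLp 2 (fun x => (f i x : ℂ)))]
    rw [StarAlgEquiv.apply_symm_apply]
    change (φ (WithLp.toLp 2 (fun x => (f i x : ℂ)))).ofLp = _
    rw [hφ]

theorem norm_toLp_unitary_mulVec {β : Type*} [Fintype β] [DecidableEq β]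
    (U : Matrix.unitaryGroup β ℂ) (x : β → ℂ) :
    ‖(WithLp.toLp 2 (Matrix.mulVec U.1 x) : EuclideanSpace ℂ β)‖ = ‖WithLp.toLp 2 x‖ := by
  rw [← Matrix.toEuclideanCLM_toLp]
  exact Unitary.norm_map ⟨_, Unitary.map_mem (Matrix.toEuclideanCLM (n := β) (𝕜 := ℂ)) U.2⟩ _

/-! ## Weighted decision trees -/

/-- A classical adaptive query procedure. Every query carries a weight `w`: reading `true` costs
`w`, reading `false` costs `w⁻¹`. -/
inductive QueryTree (Q α : Type) : Type
  | ret (a : α) : QueryTree Q α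
  | query (e : Q) (w : ℝ) (hw : 0 < w) (next : Bool → QueryTree Q α) : QueryTree Q α

namespace QueryTree

variable {Q α β : Type}

/-- The value returned on the input `x`. -/
def eval : QueryTree Q α → (Q → Bool) → α
  | ret a, _ => a
  | query e _ _ next, x => (next (x e)).eval x

/-- The total weighted cost on the input `x`. -/
noncomputable def cost : QueryTree Q α → (Q → Bool) → ℝ
  | ret _, _ => 0
  | query e w _ next, x => (if x e then w else w⁻¹) + (next (x e)).cost x

/-- Sequential composition. -/
def bind : QueryTree Q α → (α → QueryTree Q β) → QueryTree Q β
  | ret a, f => f a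
  | query e w hw next, f => query e w hw fun b => (next b).bind f

@[simp] theorem eval_ret (a : α) (x : Q → Bool) : (ret a).eval x = a := rfl

@[simp] theorem cost_ret (a : α) (x : Q → Bool) : (ret a).cost x = 0 := rfl

@[simp] theorem eval_query (e : Q) (w : ℝ) (hw : 0 < w) (next : Bool → QueryTree Q α)
    (x : Q → Bool) : (query e w hw next).eval x = (next (x e)).eval x := rfl

@[simp] theorem cost_query (e : Q) (w : ℝ) (hw : 0 < w) (next : Bool → QueryTree Q α)
    (x : Q → Bool) :
    (query e w hw next).cost x = (if x e then w else w⁻¹) + (next (x e)).cost x := rfl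

@[simp] theorem eval_bind (t : QueryTree Q α) (f : α → QueryTree Q β) (x : Q → Bool) :
    (t.bind f).eval x = (f (t.eval x)).eval x := by
  induction t with
  | ret a => rfl
  | query e w hw next ih => exact ih (x e)

@[simp] theorem cost_bind (t : QueryTree Q α) (f : α → QueryTree Q β) (x : Q → Bool) :
    (t.bind f).cost x = t.cost x + (f (t.eval x)).cost x := by
  induction t with
  | ret a => simp [bind]
  | query e w hw next ih => simp [bind, ih, add_assoc]

end QueryTree

/-! ## Catalysts -/

open Classical in
/-- A catalyst for a decision tree: vectors `v G` whose Gram matrix drops, under the query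
operators, by exactly the indicator that the inputs reach different leaves. -/
structure Catalyst {n : ℕ} {α : Type} (t : QueryTree (VertexPair n) α) where
  Work : Type
  fintypeWork : Fintype Work
  Leaf : Type
  fintypeLeaf : Fintype Leaf
  leaf : SimpleGraph (Fin n) → Leaf
  label : Leaf → α
  vec : SimpleGraph (Fin n) → QueryBasis n Work → ℝ
  label_leaf : ∀ G, label (leaf G) = t.eval (adjBit G)
  sum_sq : ∀ G, ∑ b, vec G b * vec G b = t.cost (adjBit G)
  gram : ∀ G G', ∑ b, vec G b * vec G' b -
    ∑ b, vec G (oracleMap G b) * vec G' (oracleMap G' b) = 1 - if leaf G = leaf G' then 1 else 0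

theorem sum_queryBasis_option_sigma {n : ℕ} {W : Bool → Type} [∀ b, Fintype (W b)]
    (F : QueryBasis n (Option (Σ b, W b)) → ℝ) :
    ∑ x, F x = (∑ e, ∑ q, F (e, q, none)) +
      ∑ b, ∑ x : QueryBasis n (W b), F (x.1, x.2.1, some ⟨b, x.2.2⟩) := by
  simp only [QueryBasis, Fintype.sum_prod_type, Fintype.sum_option, Fintype.sum_sigma,
    Finset.sum_add_distrib, Fintype.sum_bool]
  ring

open Classical in
theorem exists_catalyst {n : ℕ} {α : Type} (t : QueryTree (VertexPair n) α) :
    Nonempty (Catalyst t) := by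
  induction t with
  | ret a =>
    exact ⟨⟨Unit, inferInstance, Unit, inferInstance, fun _ => (), fun _ => a, fun _ _ => 0,
      fun _ => rfl, by simp, by simp⟩⟩
  | query e w hw next ih =>
    have c : ∀ b, Catalyst (next b) := fun b => Classical.choice (ih b)
    let hW : ∀ b, Fintype (c b).Work := fun b => (c b).fintypeWork
    let hL : ∀ b, Fintype (c b).Leaf := fun b => (c b).fintypeLeaf
    -- The squares are the two costs of the query, and the product of the two amplitudes is 1, the
    -- drop needed between different answers.
    let amp : Bool → ℝ := fun b => if b then Real.sqrt w else Real.sqrt w⁻¹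
    have hmul : ∀ b b', b ≠ b' → amp b * amp b' = 1 := by
      have h1 : Real.sqrt w ≠ 0 := (Real.sqrt_pos.2 hw).ne'
      intro b b' hb
      cases b <;> cases b' <;> simp_all [amp]
    have hself : ∀ b, amp b * amp b = if b then w else w⁻¹ := by
      intro b
      cases b
      · simp only [amp, Bool.false_eq_true, if_false]
        exact Real.mul_self_sqrt (inv_nonneg.2 hw.le)
      · simp only [amp, if_true]
        exact Real.mul_self_sqrt hw.le
    let v : SimpleGraph (Fin n) → QueryBasis n (Option (Σ b, (c b).Work)) → ℝ := fun G x =>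
      match x with
      | (e', q, none) => if e' = e ∧ q = false then amp (adjBit G e) else 0
      | (e', q, some ⟨b, u⟩) => if adjBit G e = b then (c b).vec G (e', q, u) else 0
    have hv0 : ∀ G e' q, v G (e', q, none) =
        if e' = e ∧ q = false then amp (adjBit G e) else 0 := fun _ _ _ => rfl
    have hv1 : ∀ G b (x : QueryBasis n (c b).Work), v G (x.1, x.2.1, some ⟨b, x.2.2⟩) =
        if adjBit G e = b then (c b).vec G x else 0 := fun _ _ _ => rfl
    have hvo1 : ∀ G b (x : QueryBasis n (c b).Work),
        v G (oracleMap G (x.1, x.2.1, some ⟨b, x.2.2⟩)) =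
        if adjBit G e = b then (c b).vec G (oracleMap G x) else 0 := fun _ _ _ => rfl
    have hvo0 : ∀ G e' q, v G (oracleMap G (e', q, none)) =
        if e' = e ∧ q = adjBit G e then amp (adjBit G e) else 0 := by
      intro G e' q
      change (if e' = e ∧ xor q (adjBit G e') = false then amp (adjBit G e) else 0) = _
      by_cases h : e' = e
      · subst h
        simp
      · simp [h]
    have s1 : ∀ G G', ∑ x, v G x * v G' x = amp (adjBit G e) * amp (adjBit G' e) +
        if adjBit G e = adjBit G' e then
          ∑ x, (c (adjBit G e)).vec G x * (c (adjBit G e)).vec G' x else 0 := by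
      intro G G'
      rw [sum_queryBasis_option_sigma]
      simp only [hv0, hv1]
      congr 1
      · rw [Finset.sum_eq_single e] <;> simp +contextual
      · rw [Finset.sum_eq_single (adjBit G e)]
        · by_cases h : adjBit G e = adjBit G' e
          · simp [h]
          · simp [h, Ne.symm h]
        · intro b _ hb
          simp [Ne.symm hb]
        · simp
    -- After the query the answer bit of the fresh part holds the answer, so different answers make
    -- the whole vectors orthogonal.
    have s2 : ∀ G G', ∑ x, v G (oracleMap G x) * v G' (oracleMap G' x) =
        (if adjBit G e = adjBit G' e then amp (adjBit G e) * amp (adjBit G' e) +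
          ∑ x, (c (adjBit G e)).vec G (oracleMap G x) * (c (adjBit G e)).vec G' (oracleMap G' x)
          else 0) := by
      intro G G'
      rw [sum_queryBasis_option_sigma]
      simp only [hvo0, hvo1]
      rw [Finset.sum_eq_single e, Finset.sum_eq_single (adjBit G e),
        Finset.sum_eq_single (adjBit G e)]
      · by_cases h : adjBit G e = adjBit G' e
        · simp [h]
        · simp [h, Ne.symm h]
      · intro b _ hb
        simp [Ne.symm hb]
      · simp
      · intro b _ hb
        simp [hb]
      · simp
      · intro b _ hb
        simp [hb]
      · simp
    refine ⟨⟨Option (Σ b, (c b).Work), inferInstance, Σ b, (c b).Leaf, inferInstance,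
      fun G => ⟨adjBit G e, (c (adjBit G e)).leaf G⟩, fun l => (c l.1).label l.2, v,
      fun G => (c _).label_leaf G, ?_, ?_⟩⟩
    · intro G
      have := (c (adjBit G e)).sum_sq G
      rw [s1, if_pos rfl, hself, QueryTree.cost_query]
      exact congrArg _ this
    · intro G G'
      rw [s1, s2]
      by_cases h : adjBit G e = adjBit G' e
      · have := (c (adjBit G e)).gram G G'
        rw [if_pos h, if_pos h, add_sub_add_left_eq_sub]
        have hl : ((⟨adjBit G e, (c (adjBit G e)).leaf G⟩ : Σ b, (c b).Leaf) =
            ⟨adjBit G' e, (c (adjBit G' e)).leaf G'⟩) ↔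
            (c (adjBit G e)).leaf G = (c (adjBit G e)).leaf G' := by
          rw [← h]
          simp
        simp only [hl]
        convert this
      · rw [if_neg h, if_neg h, hmul _ _ h, if_neg]
        · simp
        · intro h'
          exact h (congrArg Sigma.fst h')

/-! ## From decision trees to quantum query algorithms -/

theorem norm_toLp_applyOracle {n : ℕ} {W : Type} [Fintype W] (G : SimpleGraph (Fin n))
    (ψ : QueryBasis n W → ℂ) :
    ‖(WithLp.toLp 2 (applyOracle G ψ) : EuclideanSpace ℂ (QueryBasis n W))‖ =
      ‖(WithLp.toLp 2 ψ : EuclideanSpace ℂ (QueryBasis n W))‖ := by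
  have h : Function.Involutive (oracleMap (W := W) G) := oracleMap_oracleMap G
  rw [EuclideanSpace.norm_eq, EuclideanSpace.norm_eq]
  congr 1
  exact Equiv.sum_comp (h.toPerm _) fun b => ‖ψ b‖ ^ 2

theorem norm_toLp_ofReal_le {β : Type*} [Fintype β] (f : β → ℝ) (r : ℝ) (hr : 0 ≤ r)
    (hf : ∑ x, f x ^ 2 ≤ r ^ 2) :
    ‖(WithLp.toLp 2 (fun x => (f x : ℂ)) : EuclideanSpace ℂ β)‖ ≤ r := by
  refine abs_le_of_sq_le_sq' ?_ hr |>.2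
  rw [EuclideanSpace.norm_sq_eq]
  simpa using hf

-- Projecting onto the accepted basis states fixes `τ` and does not lengthen the error, so the
-- accepted part of `ψ` has norm at least 5/6, and 25/36 > 2/3.
open Classical in
theorem two_thirds_le_sum_of_norm_sub_le {β : Type*} [Fintype β] (T : β → Prop)
    (ψ τ : β → ℂ) (hτ : ∀ x, ¬ T x → τ x = 0)
    (h1 : ‖(WithLp.toLp 2 τ : EuclideanSpace ℂ β)‖ = 1)
    (h2 : ‖(WithLp.toLp 2 (τ - ψ) : EuclideanSpace ℂ β)‖ ≤ 1 / 6) :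
    (2 / 3 : ℝ) ≤ ∑ x, if T x then ‖ψ x‖ ^ 2 else 0 := by
  let P : (β → ℂ) → EuclideanSpace ℂ β := fun φ => WithLp.toLp 2 fun x => if T x then φ x else 0
  have hP : ∀ φ, ‖P φ‖ ≤ ‖(WithLp.toLp 2 φ : EuclideanSpace ℂ β)‖ := by
    intro φ
    refine abs_le_of_sq_le_sq' ?_ (norm_nonneg _) |>.2
    rw [EuclideanSpace.norm_sq_eq, EuclideanSpace.norm_sq_eq]
    refine Finset.sum_le_sum fun x _ => ?_
    by_cases h : T x <;> simp [P, h]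
  have hsum : WithLp.toLp 2 τ = P ψ + P (τ - ψ) := by
    ext x
    by_cases h : T x <;> simp [P, h, hτ]
  have h3 : 1 - 1 / 6 ≤ ‖P ψ‖ := by
    have := norm_add_le (P ψ) (P (τ - ψ))
    rw [← hsum, h1] at this
    linarith [(hP (τ - ψ)).trans h2]
  have h4 : ∑ x, (if T x then ‖ψ x‖ ^ 2 else 0) = ‖P ψ‖ ^ 2 := by
    rw [EuclideanSpace.norm_sq_eq]
    refine Finset.sum_congr rfl fun x _ => ?_
    by_cases h : T x <;> simp [P, h]
  rw [h4]
  nlinarith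

/-- If ideal states `Φ t` have Gram matrices compatible with the query operators, an algorithm can
follow them from any start state to any final state that are close enough to the ideal ones. -/
theorem exists_algorithm_of_states {n : ℕ} {α Work : Type} [Fintype Work] [DecidableEq Work]
    (init : QueryBasis n Work) (out : QueryBasis n Work → α) (K : ℕ)
    (Φ : ℕ → SimpleGraph (Fin n) → QueryBasis n Work → ℝ) (start : QueryBasis n Work → ℝ)
    (hstart : ∑ x, start x * start x = 1)
    (hgram : ∀ t < K, ∀ G G', ∑ x, Φ t G (oracleMap G x) * Φ t G' (oracleMap G' x) =
      ∑ x, Φ (t + 1) G x * Φ (t + 1) G' x) :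
    ∃ A : QuantumQueryAlgorithm n α, A.queries = K ∧
      ∀ G S (target : QueryBasis n Work → ℝ), (∀ x, out x ∉ S → target x = 0) →
        ∑ x, target x ^ 2 = 1 → ∑ x, (Φ 0 G x - start x) ^ 2 ≤ (1 / 12) ^ 2 →
        ∑ x, (target x - Φ K G x) ^ 2 ≤ (1 / 12) ^ 2 → 2 / 3 ≤ A.outputProb G S := by
  obtain ⟨U0, hU0⟩ := exists_unitaryGroup_mulVec (fun _ : Unit => Pi.single init (1 : ℝ))
    (fun _ => start) (by simp [hstart, Pi.single_apply])
  have hstep : ∀ t, ∃ U : Matrix.unitaryGroup (QueryBasis n Work) ℂ, t < K → ∀ G,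
      Matrix.mulVec U.1 (fun x => (Φ t G (oracleMap G x) : ℂ)) =
        fun x => (Φ (t + 1) G x : ℂ) := by
    intro t
    by_cases ht : t < K
    · obtain ⟨U, hU⟩ := exists_unitaryGroup_mulVec (fun G x => Φ t G (oracleMap G x)) (Φ (t + 1))
        (hgram t ht)
      exact ⟨U, fun _ => hU⟩
    · exact ⟨1, fun h => absurd h ht⟩
  choose U hU using hstep
  let A : QuantumQueryAlgorithm n α :=
    { queries := K
      Work := Work
      fintypeWork := inferInstance
      decidableEqWork := inferInstance
      init := init
      -- `U0` prepares `start`; the unitary that leads from ideal state t to t + 1 is applied at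
      -- position t + 1.
      U := fun t => Nat.casesOn t U0 U
      output := out }
  refine ⟨A, rfl, fun G S target hsupp htar h0 hK => ?_⟩
  have hinit : A.state G 0 = fun x => (start x : ℂ) := by
    have := hU0 ()
    rw [← this]
    change Matrix.mulVec U0.1 (Pi.single init 1) = _
    congr 1
    funext x
    by_cases h : x = init
    · subst h
      simp
    · simp [h]
  -- Actual and ideal states pass through the same norm-preserving maps, so their initial distance
  -- persists.
  have herr : ∀ t ≤ K,
      ‖(WithLp.toLp 2 ((fun x => (Φ t G x : ℂ)) - A.state G t) :
        EuclideanSpace ℂ (QueryBasis n Work))‖ ≤ 1 / 12 := by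
    intro t
    induction t with
    | zero =>
      intro _
      have := norm_toLp_ofReal_le (fun x => Φ 0 G x - start x) (1 / 12) (by norm_num) h0
      convert this using 3
      rw [hinit]
      funext x
      simp
    | succ t ih =>
      intro ht
      refine le_of_eq_of_le ?_ (ih (by omega))
      rw [← hU t ht G]
      change ‖(WithLp.toLp 2 (Matrix.mulVec (U t).1 _ -
        Matrix.mulVec (U t).1 (applyOracle G (A.state G t))) :
        EuclideanSpace ℂ (QueryBasis n Work))‖ = _
      rw [← Matrix.mulVec_sub, norm_toLp_unitary_mulVec, ← norm_toLp_applyOracle G (_ - A.state G t)]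
      rfl
  have htn : ‖(WithLp.toLp 2 (fun x => (target x : ℂ)) :
      EuclideanSpace ℂ (QueryBasis n Work))‖ = 1 := by
    rw [← pow_left_inj₀ (norm_nonneg _) zero_le_one two_ne_zero, EuclideanSpace.norm_sq_eq]
    simpa using htar
  have hfin : ‖(WithLp.toLp 2 ((fun x => (target x : ℂ)) - A.state G K) :
      EuclideanSpace ℂ (QueryBasis n Work))‖ ≤ 1 / 6 := by
    have h1 := norm_toLp_ofReal_le (fun x => target x - Φ K G x) (1 / 12) (by norm_num) hK
    have h2 := herr K le_rfl
    have h3 : (WithLp.toLp 2 ((fun x => (target x : ℂ)) - A.state G K) :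
        EuclideanSpace ℂ (QueryBasis n Work)) =
        WithLp.toLp 2 (fun x => ((target x - Φ K G x : ℝ) : ℂ)) +
        WithLp.toLp 2 ((fun x => (Φ K G x : ℂ)) - A.state G K) := by
      ext x
      simp
    rw [h3]
    exact (norm_add_le _ _).trans (by linarith)
  have := two_thirds_le_sum_of_norm_sub_le (fun x => out x ∈ S) (A.state G K)
    (fun x => (target x : ℂ)) (fun x hx => by simp [hsupp x hx]) htn hfin
  exact this

/-! ### Following the catalytic states -/

/-- A real state on a work register `W ⊕ H`: `v` on `W`, and on `H` the amplitudes `c`, spread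
evenly over the two values of the answer bit so that queries leave them alone. -/
noncomputable def splitState {n : ℕ} {W H : Type} (e₀ : VertexPair n) (c : H → ℝ)
    (v : QueryBasis n W → ℝ) (x : QueryBasis n (W ⊕ H)) : ℝ :=
  Sum.elim (fun w => v (x.1, x.2.1, w)) (fun h => if x.1 = e₀ then c h else 0) x.2.2

theorem splitState_oracleMap {n : ℕ} {W H : Type} (G : SimpleGraph (Fin n)) (e₀ : VertexPair n)
    (c : H → ℝ) (v : QueryBasis n W → ℝ) (x : QueryBasis n (W ⊕ H)) :
    splitState e₀ c v (oracleMap G x) = splitState e₀ c (fun y => v (oracleMap G y)) x := rfl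

theorem sum_splitState_mul {n : ℕ} {W H : Type} [Fintype W] [Fintype H] (e₀ : VertexPair n)
    (c c' : H → ℝ) (v v' : QueryBasis n W → ℝ) :
    ∑ x, splitState e₀ c v x * splitState e₀ c' v' x = 2 * ∑ h, c h * c' h + ∑ x, v x * v' x := by
  simp only [QueryBasis, Fintype.sum_prod_type, Fintype.sum_sum_type, splitState, Sum.elim_inl,
    Sum.elim_inr, Fintype.sum_bool, Finset.sum_add_distrib, mul_ite, ite_mul, mul_zero, zero_mul]
  have : ∀ a : VertexPair n, ∑ h, (if a = e₀ then if a = e₀ then c h * c' h else 0 else 0) =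
      if a = e₀ then ∑ h, c h * c' h else 0 := by
    intro a
    by_cases h : a = e₀ <;> simp [h]
  simp only [this, Finset.sum_ite_eq', Finset.mem_univ, if_true]
  ring

-- The ideal state after s queries has squared amplitude (K - s)/K on the start, s/K on the leaf,
-- and carries the catalyst scaled by 1/√K. The constant 144 = 12² keeps the scaled catalyst's norm
-- at most 1/12, the error allowed at each end.
open Classical in
theorem QueryTree.exists_algorithm {n : ℕ} (e₀ : VertexPair n) {α : Type}
    (t : QueryTree (VertexPair n) α) (K : ℕ) (hK : 0 < K)
    (hcost : ∀ G, 144 * t.cost (adjBit G) ≤ K) :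
    ∃ A : QuantumQueryAlgorithm n α, A.queries = K ∧
      ∀ G S, t.eval (adjBit G) ∈ S → 2 / 3 ≤ A.outputProb G S := by
  obtain ⟨c⟩ := exists_catalyst t
  let := c.fintypeWork
  let := c.fintypeLeaf
  have hK' : (0 : ℝ) < K := by exact_mod_cast hK
  -- The factor 2 in the denominators offsets the two values of the answer bit over which
  -- `splitState` spreads each amplitude.
  let amp : ℝ → ℝ → SimpleGraph (Fin n) → Option c.Leaf → ℝ := fun a b G h =>
    match h with
    | none => Real.sqrt (a / (2 * K))
    | some l => if l = c.leaf G then Real.sqrt (b / (2 * K)) else 0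
  have hamp : ∀ a b, 0 ≤ a → 0 ≤ b → ∀ G G', ∑ h, amp a b G h * amp a b G' h =
      a / (2 * K) + if c.leaf G = c.leaf G' then b / (2 * K) else 0 := by
    intro a b ha hb G G'
    rw [Fintype.sum_option]
    congr 1
    · exact Real.mul_self_sqrt (by positivity)
    · rw [Finset.sum_eq_single (c.leaf G)]
      · by_cases h : c.leaf G = c.leaf G'
        · simp only [amp, h, if_true]
          exact Real.mul_self_sqrt (by positivity)
        · simp [amp, h]
      · intro l _ hl
        simp [amp, hl]
      · simp
  let vs : SimpleGraph (Fin n) → QueryBasis n c.Work → ℝ := fun G x => (Real.sqrt K)⁻¹ * c.vec G x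
  have hs : (Real.sqrt K)⁻¹ * (Real.sqrt K)⁻¹ = (K : ℝ)⁻¹ := by
    rw [← mul_inv, Real.mul_self_sqrt hK'.le]
  have hvs : ∀ G, ∑ x, vs G x ^ 2 ≤ (1 / 12) ^ 2 := by
    intro G
    have h1 : ∑ x, vs G x ^ 2 = (K : ℝ)⁻¹ * t.cost (adjBit G) := by
      rw [← c.sum_sq, Finset.mul_sum, ← hs]
      exact Finset.sum_congr rfl fun x _ => by simp only [vs]; ring
    rw [h1, inv_mul_le_iff₀ hK']
    linarith [hcost G]
  let Φ : ℕ → SimpleGraph (Fin n) → QueryBasis n (c.Work ⊕ Option c.Leaf) → ℝ := fun s G =>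
    splitState e₀ (amp (K - s) s G) (vs G)
  -- Only supplies a default output off the leaf states, where the target has no amplitude.
  have hα : Nonempty α := ⟨t.eval (adjBit ⊥)⟩
  let out : QueryBasis n (c.Work ⊕ Option c.Leaf) → α := fun x =>
    match x.2.2 with
    | Sum.inr (some l) => c.label l
    | _ => Classical.choice hα
  have hzero : ∀ a b G, splitState e₀ (amp a b G) (vs G) -
      splitState e₀ (amp a b G) (fun _ => 0) = splitState e₀ (fun _ => 0) (vs G) := by
    intro a b G
    funext ⟨e, q, w⟩
    rcases w with w | h <;> simp [splitState]
  obtain ⟨A, hA, hA'⟩ := exists_algorithm_of_states (e₀, false, Sum.inr none) out K Φ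
    (splitState e₀ (amp K 0 ⊥) fun _ => 0) (by
      rw [sum_splitState_mul, hamp _ _ hK'.le le_rfl]
      simp only [zero_div, ite_self, mul_zero, Finset.sum_const_zero, add_zero]
      field_simp) (by
      intro s hs' G G'
      simp only [Φ, splitState_oracleMap]
      rw [sum_splitState_mul, sum_splitState_mul, hamp, hamp]
      · have h1 : ∑ x, vs G (oracleMap G x) * vs G' (oracleMap G' x) =
            (K : ℝ)⁻¹ * ∑ x, c.vec G (oracleMap G x) * c.vec G' (oracleMap G' x) := by
          rw [Finset.mul_sum, ← hs]
          exact Finset.sum_congr rfl fun x _ => by simp only [vs]; ring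
        have h2 : ∑ x, vs G x * vs G' x = (K : ℝ)⁻¹ * ∑ x, c.vec G x * c.vec G' x := by
          rw [Finset.mul_sum, ← hs]
          exact Finset.sum_congr rfl fun x _ => by simp only [vs]; ring
        rw [h1, h2]
        -- The catalyst's drop, divided by K, exactly balances the transfer of 1/K from the start to
        -- the leaf.
        have h3 := c.gram G G'
        rw [sub_eq_iff_eq_add] at h3
        rw [h3]
        push_cast
        by_cases h : c.leaf G = c.leaf G'
        · simp only [h, if_true]
          field_simp
          ring
        · simp only [h, if_false]
          field_simp
          ring
      · have : ((s + 1 : ℕ) : ℝ) ≤ K := by exact_mod_cast hs'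
        linarith
      · positivity
      · have : (s : ℝ) ≤ K := by exact_mod_cast hs'.le
        linarith
      · positivity)
  refine ⟨A, hA, fun G S hS => hA' G S (splitState e₀ (amp 0 K G) fun _ => 0) ?_ ?_ ?_ ?_⟩
  · rintro ⟨e, q, w⟩ hx
    rcases w with w | _ | l
    · rfl
    · simp [splitState, amp]
    · have : l ≠ c.leaf G := by
        rintro rfl
        exact hx (by simpa [out, c.label_leaf] using hS)
      simp [splitState, amp, this]
  · simp only [sq]
    rw [sum_splitState_mul, hamp _ _ le_rfl hK'.le]
    simp only [zero_div, if_true, mul_zero, Finset.sum_const_zero, add_zero, zero_add]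
    field_simp
  · have h0 : Φ 0 G = splitState e₀ (amp K 0 G) (vs G) := by
      simp only [Φ, Nat.cast_zero, sub_zero]
    -- With no amplitude on the leaf the state does not depend on the graph, so `⊥` may stand for
    -- any input.
    have h1 : amp K 0 ⊥ = amp K 0 G := by
      funext h
      rcases h with _ | l <;> simp [amp]
    have h2 : ∀ x, Φ 0 G x - splitState e₀ (amp K 0 ⊥) (fun _ => 0) x =
        splitState e₀ (fun _ => 0) (vs G) x := by
      intro x
      rw [h0, h1]
      exact congrFun (hzero _ _ _) x
    simp only [h2, sq]
    rw [sum_splitState_mul]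
    simpa [sq] using hvs G
  · have h2 : ∀ x, Φ K G x - splitState e₀ (amp 0 K G) (fun _ => 0) x =
        splitState e₀ (fun _ => 0) (vs G) x := by
      intro x
      simp only [Φ, sub_self]
      exact congrFun (hzero _ _ _) x
    have h3 : ∀ x, (splitState e₀ (amp 0 K G) (fun _ => 0) x - Φ K G x) ^ 2 =
        splitState e₀ (fun _ => 0) (vs G) x * splitState e₀ (fun _ => 0) (vs G) x := by
      intro x
      rw [← h2]
      ring
    simp only [h3]
    rw [sum_splitState_mul]
    simpa [sq] using hvs G

/-! ## Augmenting matchings -/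

section Matching

variable {n : ℕ} {G : SimpleGraph (Fin n)}

/-- The vertices that the edges of `M` cover. -/
def coveredVertices (M : Finset (Sym2 (Fin n))) : Finset (Fin n) :=
  M.biUnion Sym2.toFinset

theorem mem_coveredVertices {M : Finset (Sym2 (Fin n))} {v : Fin n} :
    v ∈ coveredVertices M ↔ ∃ e ∈ M, v ∈ e := by
  simp [coveredVertices]

theorem isEdgeMatching_empty : IsEdgeMatching G ∅ := by
  simp [IsEdgeMatching]

theorem IsEdgeMatching.mono {M N : Finset (Sym2 (Fin n))} (hM : IsEdgeMatching G M) (h : N ⊆ M) :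
    IsEdgeMatching G N :=
  ⟨fun e he => hM.1 e (h he), fun e he f hf => hM.2 e (h he) f (h hf)⟩

theorem IsEdgeMatching.insert_edge {M : Finset (Sym2 (Fin n))} {e : Sym2 (Fin n)}
    (hM : IsEdgeMatching G M) (he : e ∈ G.edgeSet) (h : ∀ v ∈ e, v ∉ coveredVertices M) :
    IsEdgeMatching G (insert e M) := by
  simp only [mem_coveredVertices, not_exists, not_and] at h
  refine ⟨fun f hf => ?_, fun f hf g hg v hvf hvg => ?_⟩
  · rcases Finset.mem_insert.1 hf with rfl | hf
    exacts [he, hM.1 f hf]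
  · rcases Finset.mem_insert.1 hf with hf | hf <;> rcases Finset.mem_insert.1 hg with hg | hg
    · rw [hf, hg]
    · exact absurd hvg (h v (hf ▸ hvf) g hg)
    · exact absurd hvf (h v (hg ▸ hvg) f hf)
    · exact hM.2 f hf g hg v hvf hvg

theorem notMem_of_notMem_coveredVertices {M : Finset (Sym2 (Fin n))} {a b : Fin n}
    (h : a ∉ coveredVertices M) : s(a, b) ∉ M := fun hm =>
  h (mem_coveredVertices.2 ⟨_, hm, Sym2.mem_mk_left a b⟩)

theorem coveredVertices_insert (M : Finset (Sym2 (Fin n))) (a b : Fin n) :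
    coveredVertices (insert s(a, b) M) = insert a (insert b (coveredVertices M)) := by
  ext v
  simp [mem_coveredVertices, or_assoc]

theorem IsEdgeMatching.card_coveredVertices {M : Finset (Sym2 (Fin n))}
    (hM : IsEdgeMatching G M) : (coveredVertices M).card = 2 * M.card := by
  rw [coveredVertices, Finset.card_biUnion, Finset.sum_congr rfl (g := fun _ => 2)]
  · simp [mul_comm]
  · intro e he
    exact Sym2.card_toFinset_of_not_isDiag e (G.not_isDiag_of_mem_edgeSet (hM.1 e he))
  · intro e he f hf hne
    rw [Function.onFun, Finset.disjoint_left]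
    intro v hv hv'
    exact hne (hM.2 e he f hf v (Sym2.mem_toFinset.1 hv) (Sym2.mem_toFinset.1 hv'))

/-- Berge's augmentation: a matching `N` that is smaller than `M` can be replaced within `N ∪ M` by
one with one more edge, which still covers all that `N` covers. -/
theorem IsEdgeMatching.exists_augment {N M : Finset (Sym2 (Fin n))} (hN : IsEdgeMatching G N)
    (hM : IsEdgeMatching G M) (hlt : N.card < M.card) :
    ∃ N', IsEdgeMatching G N' ∧ N' ⊆ N ∪ M ∧ N'.card = N.card + 1 ∧
      coveredVertices N ⊆ coveredVertices N' := by
  induction hc : N.card generalizing N M with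
  | zero =>
    obtain ⟨e, he⟩ : M.Nonempty := Finset.card_pos.1 (by omega)
    rw [Finset.card_eq_zero] at hc
    subst hc
    refine ⟨{e}, hM.mono (by simpa using he), by simpa using he, by simp, ?_⟩
    simp [coveredVertices]
  | succ c ih =>
    -- `M` covers 2|M| > 2|N| vertices.
    obtain ⟨x, hxM, hxN⟩ : ∃ x ∈ coveredVertices M, x ∉ coveredVertices N := by
      by_contra! h
      have := Finset.card_le_card (show coveredVertices M ⊆ coveredVertices N from h)
      rw [hM.card_coveredVertices, hN.card_coveredVertices] at this
      omega
    obtain ⟨e, he, hxe⟩ := mem_coveredVertices.1 hxM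
    obtain ⟨a, rfl⟩ := hxe
    by_cases haN : a ∈ coveredVertices N
    · obtain ⟨f, hf, haf⟩ := mem_coveredVertices.1 haN
      obtain ⟨b, rfl⟩ := haf
      -- Two steps of the alternating path, xa in `M` and ab in `N`, are cut off. The smaller
      -- augmentation misses x and a, so one of xa and ab can be put back.
      obtain ⟨N', hN', hsub, hcard, hcov⟩ := ih (hN.mono (Finset.erase_subset s(a, b) N))
        (hM.mono (Finset.erase_subset s(x, a) M))
        (by rw [Finset.card_erase_of_mem hf, Finset.card_erase_of_mem he]; omega)
        (by rw [Finset.card_erase_of_mem hf, hc]; rfl)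
      have hxN' : x ∉ coveredVertices N' := by
        rw [mem_coveredVertices]
        rintro ⟨g, hg, hxg⟩
        rcases Finset.mem_union.1 (hsub hg) with h | h
        · exact hxN (mem_coveredVertices.2 ⟨g, Finset.mem_of_mem_erase h, hxg⟩)
        · exact Finset.ne_of_mem_erase h
            (hM.2 g (Finset.mem_of_mem_erase h) _ he x hxg (Sym2.mem_mk_left x a))
      have haN' : a ∉ coveredVertices N' := by
        rw [mem_coveredVertices]
        rintro ⟨g, hg, hag⟩
        rcases Finset.mem_union.1 (hsub hg) with h | h
        · exact Finset.ne_of_mem_erase h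
            (hN.2 g (Finset.mem_of_mem_erase h) _ hf a hag (Sym2.mem_mk_left a b))
        · exact Finset.ne_of_mem_erase h
            (hM.2 g (Finset.mem_of_mem_erase h) _ he a hag (Sym2.mem_mk_right x a))
      have hcovN : coveredVertices N ⊆ insert a (insert b (coveredVertices N')) := by
        rw [← Finset.insert_erase hf, coveredVertices_insert]
        exact Finset.insert_subset_insert _ (Finset.insert_subset_insert _ hcov)
      have hsub' : N' ⊆ N ∪ M := hsub.trans
        (Finset.union_subset_union (Finset.erase_subset _ _) (Finset.erase_subset _ _))
      -- Only a and b may have lost their cover: if b is still covered, xa restores a; otherwise ab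
      -- restores both.
      by_cases hb : b ∈ coveredVertices N'
      · refine ⟨insert s(x, a) N', hN'.insert_edge (hM.1 _ he) ?_, ?_, ?_, ?_⟩
        · intro v hv
          rcases Sym2.mem_iff.1 hv with rfl | rfl
          exacts [hxN', haN']
        · exact Finset.insert_subset (Finset.mem_union_right _ he) hsub'
        · rw [Finset.card_insert_of_notMem (notMem_of_notMem_coveredVertices hxN'), hcard]
        · rw [coveredVertices_insert]
          refine hcovN.trans ?_
          rw [Finset.insert_eq_of_mem hb]
          exact Finset.subset_insert _ _
      · refine ⟨insert s(a, b) N', hN'.insert_edge (hN.1 _ hf) ?_, ?_, ?_, ?_⟩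
        · intro v hv
          rcases Sym2.mem_iff.1 hv with rfl | rfl
          exacts [haN', hb]
        · exact Finset.insert_subset (Finset.mem_union_left _ hf) hsub'
        · rw [Finset.card_insert_of_notMem (notMem_of_notMem_coveredVertices haN'), hcard]
        · rw [coveredVertices_insert]
          exact hcovN
    · refine ⟨insert s(x, a) N, hN.insert_edge (hM.1 _ he) ?_, ?_, ?_, ?_⟩
      · intro v hv
        rcases Sym2.mem_iff.1 hv with rfl | rfl
        exacts [hxN, haN]
      · exact Finset.insert_subset (Finset.mem_union_right _ he) Finset.subset_union_left
      · rw [Finset.card_insert_of_notMem (notMem_of_notMem_coveredVertices hxN), hc]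
      · rw [coveredVertices_insert]
        exact (Finset.subset_insert _ _).trans (Finset.subset_insert _ _)

/-! ### Augmentation plans relative to a known vertex set -/

open Classical in
/-- The edges of `G` with both endpoints in `K`. -/
noncomputable def edgesWithin (G : SimpleGraph (Fin n)) (K : Finset (Fin n)) :
    Finset (Sym2 (Fin n)) :=
  Finset.univ.filter fun e => e ∈ G.edgeSet ∧ ∀ v ∈ e, v ∈ K

theorem mem_edgesWithin {K : Finset (Fin n)} {e : Sym2 (Fin n)} :
    e ∈ edgesWithin G K ↔ e ∈ G.edgeSet ∧ ∀ v ∈ e, v ∈ K := by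
  simp [edgesWithin]

theorem edgesWithin_mono {K K' : Finset (Fin n)} (h : K ⊆ K') :
    edgesWithin G K ⊆ edgesWithin G K' := fun e he => by
  rw [mem_edgesWithin] at he ⊢
  exact ⟨he.1, fun v hv => h (he.2 v hv)⟩

/-- A way to improve on the matching `N`: a matching `N₀` within the known edges `H`, and at most
two uncovered vertices in `U \ D` to be matched to new vertices, for one more edge in total. -/
structure IsAugmentationPlan (U D : Finset (Fin n)) (H N N₀ : Finset (Sym2 (Fin n)))
    (B : List (Fin n)) : Prop where
  subset : N₀ ⊆ H
  disjoint : ∀ e ∈ N₀, ∀ f ∈ N₀, ∀ v : Fin n, v ∈ e → v ∈ f → e = f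
  mem : ∀ u ∈ B, u ∈ U ∧ u ∉ D ∧ u ∉ coveredVertices N₀
  nodup : B.Nodup
  card : N₀.card + B.length = N.card + 1
  length_le : B.length ≤ 2

-- Split a Berge augmentation into its edges inside `K` and those leaving `K`. As `U` is a vertex
-- cover inside `K`, each leaving edge joins a vertex of `U` to one outside `K`, and that vertex of
-- `U` cannot be in `D`. Only the ends in `U` are kept in the plan, since the outer ends are
-- replaceable.
open Classical in
theorem exists_isAugmentationPlan {U K D : Finset (Fin n)} {N M : Finset (Sym2 (Fin n))}
    (hN : IsEdgeMatching G N) (hNK : coveredVertices N ⊆ K)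
    (hU : ∀ e ∈ G.edgeSet, ∃ u ∈ U, u ∈ e) (hUK : U ⊆ K)
    (hD : ∀ u ∈ D, ∀ x, x ∉ K → ¬ G.Adj u x) (hM : IsEdgeMatching G M) (hlt : N.card < M.card) :
    ∃ N₀ B, IsAugmentationPlan U D (edgesWithin G K) N N₀ B := by
  obtain ⟨N', hN', -, hcard, hcov⟩ := hN.exists_augment hM hlt
  have hex : ∀ e, ∃ p : Fin n × Fin n, e ∈ N' → (¬ ∀ v ∈ e, v ∈ K) →
      e = s(p.1, p.2) ∧ p.1 ∈ U ∧ p.2 ∉ K := by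
    intro e
    by_cases he : e ∈ N' ∧ ¬ ∀ v ∈ e, v ∈ K
    · obtain ⟨u, huU, hue⟩ := hU e (hN'.1 e he.1)
      obtain ⟨x, rfl⟩ := hue
      refine ⟨(u, x), fun _ _ => ⟨rfl, huU, fun hx => he.2 ?_⟩⟩
      intro v hv
      rcases Sym2.mem_iff.1 hv with rfl | rfl
      exacts [hUK huU, hx]
    · have hn : 0 < n := by
        rcases Nat.eq_zero_or_pos n with h | h
        · subst h
          exact (e.inductionOn fun a _ => a.elim0)
        · exact h
      exact ⟨(⟨0, hn⟩, ⟨0, hn⟩), fun h1 h2 => absurd ⟨h1, h2⟩ he⟩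
  choose p hp using hex
  set R := N'.filter fun e => ¬ ∀ v ∈ e, v ∈ K with hR
  have hRp : ∀ e ∈ R, e ∈ N' ∧ e = s((p e).1, (p e).2) ∧ (p e).1 ∈ U ∧ (p e).2 ∉ K := by
    intro e he
    rw [hR, Finset.mem_filter] at he
    exact ⟨he.1, hp e he.1 he.2⟩
  have hmem1 : ∀ e ∈ R, (p e).1 ∈ e := fun e he => by
    have h := Sym2.mem_mk_left (p e).1 (p e).2
    rwa [← (hRp e he).2.1] at h
  have hmem2 : ∀ e ∈ R, (p e).2 ∈ e := fun e he => by
    have h := Sym2.mem_mk_right (p e).1 (p e).2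
    rwa [← (hRp e he).2.1] at h
  have hinj : Set.InjOn (fun e => (p e).1) R := fun e he f hf hef =>
    hN'.2 e (hRp e he).1 f (hRp f hf).1 (p e).1 (hmem1 e he) (by
      rw [show (p e).1 = (p f).1 from hef]
      exact hmem1 f hf)
  have hinj2 : Set.InjOn (fun e => (p e).2) R := fun e he f hf hef =>
    hN'.2 e (hRp e he).1 f (hRp f hf).1 (p e).2 (hmem2 e he) (by
      rw [show (p e).2 = (p f).2 from hef]
      exact hmem2 f hf)
  have hlen : ((R.image fun e => (p e).1).toList).length = R.card := by
    rw [Finset.length_toList, Finset.card_image_of_injOn hinj]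
  refine ⟨N'.filter fun e => ∀ v ∈ e, v ∈ K, (R.image fun e => (p e).1).toList, ?_, ?_, ?_, ?_, ?_,
    ?_⟩
  · intro e he
    rw [Finset.mem_filter] at he
    exact mem_edgesWithin.2 ⟨hN'.1 e he.1, he.2⟩
  · exact (hN'.mono (Finset.filter_subset _ _)).2
  · intro u hu
    rw [Finset.mem_toList, Finset.mem_image] at hu
    obtain ⟨e, he, rfl⟩ := hu
    obtain ⟨heN, heq, heU, heK⟩ := hRp e he
    refine ⟨heU, fun h => hD _ h _ heK ?_, ?_⟩
    · have := hN'.1 e heN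
      rw [heq] at this
      exact this
    · rw [mem_coveredVertices]
      rintro ⟨f, hf, hfu⟩
      rw [Finset.mem_filter] at hf
      have := hN'.2 e heN f hf.1 _ (hmem1 e he) hfu
      subst this
      exact heK (hf.2 _ (hmem2 e he))
  · exact Finset.nodup_toList _
  · rw [hlen, ← hcard, hR]
    exact Finset.card_filter_add_card_filter_not _
  -- The outer ends are covered by `N'` but not by `N`, which lives inside `K`; the augmentation
  -- covers exactly two more vertices, so at most two edges leave.
  · rw [hlen, ← Finset.card_image_of_injOn hinj2]
    have h1 : R.image (fun e => (p e).2) ⊆ coveredVertices N' \ coveredVertices N := by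
      intro x hx
      obtain ⟨e, he, rfl⟩ := Finset.mem_image.1 hx
      exact Finset.mem_sdiff.2 ⟨mem_coveredVertices.2 ⟨e, (hRp e he).1, hmem2 e he⟩,
        fun h => (hRp e he).2.2.2 (hNK h)⟩
    have h2 := Finset.card_le_card h1
    rw [Finset.card_sdiff_of_subset hcov, hN'.card_coveredVertices, hN.card_coveredVertices] at h2
    omega

end Matching

/-! ## The classical procedure -/

section Procedure

variable {n : ℕ} {G : SimpleGraph (Fin n)}

theorem adjBit_eq_true {e : VertexPair n} : adjBit G e = true ↔ e.1 ∈ G.edgeSet := by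
  simp [adjBit]

open Classical in
/-- Scan a list of pairs, adding to the matching `M` whatever fits, until it has `k` edges. -/
noncomputable def greedyMatching (k : ℕ) (w : ℝ) (hw : 0 < w) : List (VertexPair n) →
    Finset (Sym2 (Fin n)) → QueryTree (VertexPair n) (Finset (Sym2 (Fin n)))
  | [], M => .ret M
  | e :: L, M => if k ≤ M.card ∨ ∃ v ∈ e.1, v ∈ coveredVertices M then greedyMatching k w hw L M
      else .query e w hw fun b => greedyMatching k w hw L (if b then insert e.1 M else M)

/-- If the result stays below k edges, every listed edge was either skipped for a covered endpoint
or added, and coverage never shrinks, so the endpoints cover all listed edges. Each `true` answer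
adds an edge, so there are at most `k - M.card` of them. -/
theorem greedyMatching_spec (k : ℕ) (w : ℝ) (hw : 0 < w) (L : List (VertexPair n))
    (M : Finset (Sym2 (Fin n))) (hM : IsEdgeMatching G M) (hk : M.card ≤ k) :
    IsEdgeMatching G ((greedyMatching k w hw L M).eval (adjBit G)) ∧
    M ⊆ (greedyMatching k w hw L M).eval (adjBit G) ∧
    ((greedyMatching k w hw L M).eval (adjBit G)).card ≤ k ∧
    (((greedyMatching k w hw L M).eval (adjBit G)).card < k → ∀ e ∈ L, e.1 ∈ G.edgeSet →
      ∃ v ∈ e.1, v ∈ coveredVertices ((greedyMatching k w hw L M).eval (adjBit G))) ∧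
    (greedyMatching k w hw L M).cost (adjBit G) ≤ L.length * w⁻¹ + (k - M.card) * w := by
  have hk' : (M.card : ℝ) ≤ k := by exact_mod_cast hk
  have hw' : 0 < w⁻¹ := inv_pos.2 hw
  have hcov : ∀ {M R : Finset (Sym2 (Fin n))} {v : Fin n}, M ⊆ R → v ∈ coveredVertices M →
      v ∈ coveredVertices R := fun h hv => Finset.biUnion_subset_biUnion_of_subset_left _ h hv
  induction L generalizing M with
  | nil =>
    refine ⟨hM, subset_rfl, hk, by simp, ?_⟩
    simp only [greedyMatching, QueryTree.cost_ret, List.length_nil, Nat.cast_zero, zero_mul,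
      zero_add]
    exact mul_nonneg (by linarith) hw.le
  | cons e L ih =>
    by_cases hc : k ≤ M.card ∨ ∃ v ∈ e.1, v ∈ coveredVertices M
    · obtain ⟨h1, h2, h3, h4, h5⟩ := ih M hM hk hk'
      rw [greedyMatching, if_pos hc]
      refine ⟨h1, h2, h3, fun hlt f hf hfG => ?_, h5.trans ?_⟩
      · rcases List.mem_cons.1 hf with rfl | hf
        · rcases hc with hc | ⟨v, hv, hvM⟩
          · exact absurd (hc.trans (Finset.card_le_card h2)) (by omega)
          · exact ⟨v, hv, hcov h2 hvM⟩
        · exact h4 hlt f hf hfG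
      · rw [List.length_cons]
        push_cast
        linarith
    · rw [greedyMatching, if_neg hc]
      push Not at hc
      simp only [QueryTree.eval_query, QueryTree.cost_query, List.length_cons]
      by_cases hb : e.1 ∈ G.edgeSet
      · have hb' := adjBit_eq_true.2 hb
        rw [hb']
        simp only [if_true]
        have hnm : e.1 ∉ M := by
          obtain ⟨v, hv⟩ : ∃ v, v ∈ e.1 := ⟨_, Sym2.out_fst_mem e.1⟩
          exact fun h => hc.2 v hv (mem_coveredVertices.2 ⟨_, h, hv⟩)
        have hcard := Finset.card_insert_of_notMem hnm
        have hle : (insert e.1 M).card ≤ k := by omega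
        obtain ⟨h1, h2, h3, h4, h5⟩ := ih (insert e.1 M) (hM.insert_edge hb hc.2) hle
          (by exact_mod_cast hle)
        refine ⟨h1, (Finset.subset_insert _ _).trans h2, h3, fun hlt f hf hfG => ?_, ?_⟩
        · rcases List.mem_cons.1 hf with rfl | hf
          · exact ⟨_, Sym2.out_fst_mem f.1, mem_coveredVertices.2
              ⟨f.1, h2 (Finset.mem_insert_self _ _), Sym2.out_fst_mem f.1⟩⟩
          · exact h4 hlt f hf hfG
        · rw [hcard] at h5
          push_cast at h5 ⊢
          nlinarith
      · have hb' : adjBit G e = false := by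
          rw [← Bool.not_eq_true, adjBit_eq_true]
          exact hb
        rw [hb']
        simp only [Bool.false_eq_true, if_false]
        obtain ⟨h1, h2, h3, h4, h5⟩ := ih M hM hk hk'
        refine ⟨h1, h2, h3, fun hlt f hf hfG => ?_, ?_⟩
        · rcases List.mem_cons.1 hf with rfl | hf
          · exact absurd hfG hb
          · exact h4 hlt f hf hfG
        · push_cast
          linarith

/-- Look for a neighbour of `u` in a list. -/
def findNeighbor (w : ℝ) (hw : 0 < w) (u : Fin n) :
    List (Fin n) → QueryTree (VertexPair n) (Option (Fin n))
  | [] => .ret none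
  | x :: L => if h : ¬ (s(u, x) : Sym2 (Fin n)).IsDiag then
      .query ⟨s(u, x), h⟩ w hw fun b => if b then .ret (some x) else findNeighbor w hw u L
    else findNeighbor w hw u L

theorem findNeighbor_spec (w : ℝ) (hw : 0 < w) (u : Fin n) (L : List (Fin n)) :
    (∀ x, (findNeighbor w hw u L).eval (adjBit G) = some x → x ∈ L ∧ G.Adj u x) ∧
    ((findNeighbor w hw u L).eval (adjBit G) = none → ∀ x ∈ L, ¬ G.Adj u x) ∧
    (findNeighbor w hw u L).cost (adjBit G) ≤ L.length * w⁻¹ + w := by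
  have hw' : 0 < w⁻¹ := inv_pos.2 hw
  induction L with
  | nil => simp [findNeighbor, hw.le]
  | cons y L ih =>
    obtain ⟨h1, h2, h3⟩ := ih
    rw [findNeighbor]
    by_cases h : ¬ (s(u, y) : Sym2 (Fin n)).IsDiag
    · rw [dif_pos h]
      simp only [QueryTree.eval_query, QueryTree.cost_query, List.length_cons]
      by_cases hb : G.Adj u y
      · have hb' : adjBit G ⟨s(u, y), h⟩ = true := adjBit_eq_true.2 hb
        rw [hb']
        simp only [if_true, QueryTree.eval_ret, QueryTree.cost_ret, Option.some.injEq]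
        refine ⟨?_, by simp, ?_⟩
        · rintro x rfl
          exact ⟨List.mem_cons_self, hb⟩
        · have : 0 ≤ ((L.length + 1 : ℕ) : ℝ) * w⁻¹ := by positivity
          linarith
      · have hb' : adjBit G ⟨s(u, y), h⟩ = false := by
          rw [← Bool.not_eq_true, adjBit_eq_true]
          exact hb
        rw [hb']
        simp only [Bool.false_eq_true, if_false]
        refine ⟨fun x hx => ⟨List.mem_cons_of_mem _ (h1 x hx).1, (h1 x hx).2⟩, fun hx x hxL => ?_,
          ?_⟩
        · rcases List.mem_cons.1 hxL with rfl | hxL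
          exacts [hb, h2 hx x hxL]
        · push_cast
          linarith
    · rw [dif_neg h]
      refine ⟨fun x hx => ⟨List.mem_cons_of_mem _ (h1 x hx).1, (h1 x hx).2⟩, fun hx x hxL => ?_,
        ?_⟩
      · rcases List.mem_cons.1 hxL with rfl | hxL
        · intro hadj
          exact h fun hd => hadj.ne (Sym2.mk_isDiag_iff.1 hd)
        · exact h2 hx x hxL
      · rw [List.length_cons]
        push_cast
        linarith

/-- Query all pairs in a list, adding those that are edges to `H`. -/
def queryAll : List (VertexPair n) → Finset (Sym2 (Fin n)) →
    QueryTree (VertexPair n) (Finset (Sym2 (Fin n)))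
  | [], H => .ret H
  | e :: L, H => .query e 1 one_pos fun b => queryAll L (if b then insert e.1 H else H)

theorem mem_eval_queryAll (L : List (VertexPair n)) (H : Finset (Sym2 (Fin n)))
    (f : Sym2 (Fin n)) : f ∈ (queryAll L H).eval (adjBit G) ↔
      f ∈ H ∨ (f ∈ G.edgeSet ∧ ∃ e ∈ L, e.1 = f) := by
  induction L generalizing H with
  | nil => simp [queryAll]
  | cons e L ih =>
    rw [queryAll, QueryTree.eval_query, ih]
    by_cases hb : e.1 ∈ G.edgeSet
    · rw [adjBit_eq_true.2 hb]
      simp only [if_true, Finset.mem_insert, List.mem_cons, exists_eq_or_imp]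
      constructor
      · rintro ((rfl | h) | ⟨h, h'⟩)
        exacts [Or.inr ⟨hb, Or.inl rfl⟩, Or.inl h, Or.inr ⟨h, Or.inr h'⟩]
      · rintro (h | ⟨h, rfl | h'⟩)
        exacts [Or.inl (Or.inr h), Or.inl (Or.inl rfl), Or.inr ⟨h, h'⟩]
    · have hb' : adjBit G e = false := by
        rw [← Bool.not_eq_true, adjBit_eq_true]
        exact hb
      rw [hb']
      simp only [Bool.false_eq_true, if_false, List.mem_cons, exists_eq_or_imp]
      refine or_congr_right (and_congr_right fun hf => ⟨Or.inr, ?_⟩)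
      rintro (rfl | h)
      exacts [absurd hf hb, h]

theorem cost_queryAll (L : List (VertexPair n)) (H : Finset (Sym2 (Fin n)))
    (x : VertexPair n → Bool) : (queryAll L H).cost x = L.length := by
  induction L generalizing H with
  | nil => simp [queryAll]
  | cons e L ih =>
    rw [queryAll, QueryTree.cost_query, ih, List.length_cons]
    push_cast
    simp [add_comm]

open Classical in
/-- The pairs within `K'` that are not pairs within `K`. -/
noncomputable def newPairs (K K' : Finset (Fin n)) : List (VertexPair n) :=
  (Finset.univ.filter fun p : VertexPair n => (∀ v ∈ p.1, v ∈ K') ∧ ¬ ∀ v ∈ p.1, v ∈ K).toList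

theorem mem_newPairs {K K' : Finset (Fin n)} {p : VertexPair n} :
    p ∈ newPairs K K' ↔ (∀ v ∈ p.1, v ∈ K') ∧ ¬ ∀ v ∈ p.1, v ∈ K := by
  simp [newPairs]

theorem eval_queryAll_newPairs {K K' : Finset (Fin n)} (h : K ⊆ K') :
    (queryAll (newPairs K K') (edgesWithin G K)).eval (adjBit G) = edgesWithin G K' := by
  ext f
  rw [mem_eval_queryAll, mem_edgesWithin, mem_edgesWithin]
  constructor
  · rintro (h' | ⟨hf, e, he, rfl⟩)
    · exact ⟨h'.1, fun v hv => h (h'.2 v hv)⟩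
    · exact ⟨hf, (mem_newPairs.1 he).1⟩
  · rintro ⟨hf, hfK⟩
    by_cases hK : ∀ v ∈ f, v ∈ K
    · exact Or.inl ⟨hf, hK⟩
    · exact Or.inr ⟨hf, ⟨f, G.not_isDiag_of_mem_edgeSet hf⟩, mem_newPairs.2 ⟨hfK, hK⟩, rfl⟩

theorem length_newPairs_empty_le (K : Finset (Fin n)) :
    (newPairs ∅ K).length ≤ K.card * K.card := by
  rw [newPairs, Finset.length_toList, ← Finset.card_product]
  refine le_trans (Finset.card_le_card_of_injOn (t := (K ×ˢ K).image fun p => s(p.1, p.2))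
    Subtype.val ?_ Subtype.val_injective.injOn) Finset.card_image_le
  rintro ⟨e, he⟩ hp
  induction e with | _ a b
  have := (Finset.mem_filter.1 hp).2.1
  exact Finset.mem_image.2 ⟨(a, b), Finset.mem_product.2
    ⟨this a (Sym2.mem_mk_left a b), this b (Sym2.mem_mk_right a b)⟩, rfl⟩

theorem length_newPairs_insert_le (K : Finset (Fin n)) (x : Fin n) :
    (newPairs K (insert x K)).length ≤ K.card := by
  rw [newPairs, Finset.length_toList]
  refine le_trans (Finset.card_le_card_of_injOn (t := K.image fun y => s(x, y))
    Subtype.val ?_ Subtype.val_injective.injOn) Finset.card_image_le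
  rintro ⟨e, he⟩ hp
  induction e with | _ a b
  obtain ⟨h1, h2⟩ := (Finset.mem_filter.1 hp).2
  have ha := Finset.mem_insert.1 (h1 a (Sym2.mem_mk_left a b))
  have hb := Finset.mem_insert.1 (h1 b (Sym2.mem_mk_right a b))
  have hab : a ≠ b := fun h => he (Sym2.mk_isDiag_iff.2 h)
  refine Finset.mem_coe.2 (Finset.mem_image.2 ?_)
  rcases ha with rfl | ha
  · rcases hb with rfl | hb
    · exact absurd rfl hab
    · exact ⟨b, hb, rfl⟩
  · rcases hb with rfl | hb
    · exact ⟨a, ha, Sym2.eq_swap⟩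
    · refine absurd (fun v hv => ?_) h2
      rcases Sym2.mem_iff.1 hv with rfl | rfl
      exacts [ha, hb]

/-! ### Search states and rounds of augmentation -/

/-- What the procedure knows: all edges within `known`, some vertices that are `dead` (without
neighbours outside `known`), and a matching. -/
structure SearchState (n : ℕ) where
  known : Finset (Fin n)
  edges : Finset (Sym2 (Fin n))
  dead : Finset (Fin n)
  matching : Finset (Sym2 (Fin n))

/-- The knowledge recorded in `s` is correct for `G`. -/
structure SearchState.Valid (s : SearchState n) (G : SimpleGraph (Fin n)) (U : Finset (Fin n)) :
    Prop where
  subset_known : U ⊆ s.known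
  edges_eq : s.edges = edgesWithin G s.known
  dead_subset : s.dead ⊆ U
  not_adj : ∀ u ∈ s.dead, ∀ x, x ∉ s.known → ¬ G.Adj u x
  isEdgeMatching : IsEdgeMatching G s.matching
  matching_subset : s.matching ⊆ s.edges

theorem SearchState.Valid.coveredVertices_subset {s : SearchState n} {U : Finset (Fin n)}
    (hs : s.Valid G U) : coveredVertices s.matching ⊆ s.known := by
  intro v hv
  obtain ⟨e, he, hve⟩ := mem_coveredVertices.1 hv
  have := hs.matching_subset he
  rw [hs.edges_eq, mem_edgesWithin] at this
  exact this.2 v hve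

/-- Match the vertices in a list to new vertices, giving up at the first one that has no
neighbour outside the known vertices. -/
noncomputable def attachNew (w : ℝ) (hw : 0 < w) :
    List (Fin n) → SearchState n → QueryTree (VertexPair n) (SearchState n)
  | [], s => .ret s
  | u :: B, s => (findNeighbor w hw u s.knownᶜ.toList).bind fun o => match o with
    | none => .ret ⟨s.known, s.edges, insert u s.dead, s.matching⟩
    | some x => (queryAll (newPairs s.known (insert x s.known)) s.edges).bind fun H =>
        attachNew w hw B ⟨insert x s.known, H, s.dead, insert s(u, x) s.matching⟩

/-- Stopping at the first failure leaves two outcomes: all of `B` is matched, or one new vertex is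
dead. A found neighbour lies outside the known set, hence is uncovered and not in `B`; making it
known adds at most one pair per known vertex. -/
theorem attachNew_spec (w : ℝ) (hw : 0 < w) (U : Finset (Fin n)) (B : List (Fin n))
    (s : SearchState n) (hs : s.Valid G U)
    (hB : ∀ u ∈ B, u ∈ U ∧ u ∉ s.dead ∧ u ∉ coveredVertices s.matching) (hnd : B.Nodup) :
    ((attachNew w hw B s).eval (adjBit G)).Valid G U ∧
    s.known ⊆ ((attachNew w hw B s).eval (adjBit G)).known ∧
    ((attachNew w hw B s).eval (adjBit G)).known.card ≤ s.known.card + B.length ∧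
    ((((attachNew w hw B s).eval (adjBit G)).dead.card = s.dead.card ∧
      ((attachNew w hw B s).eval (adjBit G)).matching.card = s.matching.card + B.length) ∨
      s.dead.card + 1 = ((attachNew w hw B s).eval (adjBit G)).dead.card) ∧
    (attachNew w hw B s).cost (adjBit G) ≤
      B.length * (n * w⁻¹ + w + (s.known.card + B.length)) := by
  have hw' : 0 < w⁻¹ := inv_pos.2 hw
  induction B generalizing s with
  | nil => exact ⟨hs, subset_rfl, le_rfl, Or.inl ⟨rfl, rfl⟩, by simp [attachNew]⟩
  | cons u B ih =>
    obtain ⟨hsome, hnone, hcost⟩ := findNeighbor_spec (G := G) w hw u s.knownᶜ.toList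
    have hcost' : (findNeighbor w hw u s.knownᶜ.toList).cost (adjBit G) ≤ n * w⁻¹ + w := by
      refine hcost.trans ?_
      have : ((s.knownᶜ.toList.length : ℕ) : ℝ) ≤ n := by
        rw [Finset.length_toList]
        exact_mod_cast (Finset.card_le_univ _).trans (Fintype.card_fin n).le
      gcongr
    obtain ⟨huU, huD, huM⟩ := hB u List.mem_cons_self
    rw [attachNew]
    simp only [QueryTree.eval_bind, QueryTree.cost_bind, List.length_cons]
    rcases ho : (findNeighbor w hw u s.knownᶜ.toList).eval (adjBit G) with _ | x
    · simp only [QueryTree.eval_ret, QueryTree.cost_ret]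
      refine ⟨⟨hs.subset_known, hs.edges_eq, Finset.insert_subset huU hs.dead_subset, ?_,
        hs.isEdgeMatching, hs.matching_subset⟩, subset_rfl, by omega,
        Or.inr (Finset.card_insert_of_notMem huD).symm, ?_⟩
      · intro v hv x hx
        rcases Finset.mem_insert.1 hv with rfl | hv
        · exact hnone ho x (by simpa using hx)
        · exact hs.not_adj v hv x hx
      · push_cast
        have h1 : (0 : ℝ) ≤ B.length * (n * w⁻¹ + w + (s.known.card + (B.length + 1))) := by
          positivity
        have h2 : (0 : ℝ) ≤ s.known.card + (B.length + 1) := by positivity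
        linarith
    · obtain ⟨hxK, hadj⟩ := hsome x ho
      rw [Finset.mem_toList, Finset.mem_compl] at hxK
      simp only [QueryTree.eval_bind, QueryTree.cost_bind]
      rw [hs.edges_eq, eval_queryAll_newPairs (Finset.subset_insert x s.known), cost_queryAll]
      have hxM : x ∉ coveredVertices s.matching := fun h => hxK (hs.coveredVertices_subset h)
      have hcard : (insert s(u, x) s.matching).card = s.matching.card + 1 :=
        Finset.card_insert_of_notMem (notMem_of_notMem_coveredVertices huM)
      have hcardK := Finset.card_insert_of_notMem hxK
      obtain ⟨h1, h2, h3, h4, h5⟩ := ih ⟨insert x s.known, edgesWithin G (insert x s.known),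
        s.dead, insert s(u, x) s.matching⟩ (by
          refine ⟨hs.subset_known.trans (Finset.subset_insert _ _), rfl, hs.dead_subset,
            fun v hv y hy => hs.not_adj v hv y fun h => hy (Finset.mem_insert_of_mem h),
            hs.isEdgeMatching.insert_edge hadj ?_, Finset.insert_subset ?_ ?_⟩
          · intro v hv
            rcases Sym2.mem_iff.1 hv with rfl | rfl
            exacts [huM, hxM]
          · refine mem_edgesWithin.2 ⟨hadj, fun v hv => ?_⟩
            rcases Sym2.mem_iff.1 hv with rfl | rfl
            exacts [Finset.mem_insert_of_mem (hs.subset_known huU), Finset.mem_insert_self _ _]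
          · have := hs.matching_subset
            rw [hs.edges_eq] at this
            exact this.trans (edgesWithin_mono (Finset.subset_insert _ _))) (by
          intro v hv
          obtain ⟨hvU, hvD, hvM⟩ := hB v (List.mem_cons_of_mem _ hv)
          refine ⟨hvU, hvD, ?_⟩
          simp only [coveredVertices_insert, Finset.mem_insert, not_or]
          refine ⟨?_, ?_, hvM⟩
          · rintro rfl
            exact (List.nodup_cons.1 hnd).1 hv
          · rintro rfl
            exact hxK (hs.subset_known hvU)) (List.nodup_cons.1 hnd).2
      simp only [hcard, hcardK] at h3 h4 h5
      refine ⟨h1, (Finset.subset_insert _ _).trans h2, by omega, ?_, ?_⟩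
      · rcases h4 with ⟨h4, h4'⟩ | h4
        · exact Or.inl ⟨h4, by omega⟩
        · exact Or.inr h4
      · have hlen : ((newPairs s.known (insert x s.known)).length : ℝ) ≤ s.known.card := by
          exact_mod_cast length_newPairs_insert_le _ _
        push_cast at h5 ⊢
        have : (0 : ℝ) ≤ B.length := by positivity
        have h6 : (B.length : ℝ) * (n * w⁻¹ + w + (s.known.card + 1 + B.length)) =
          B.length * (n * w⁻¹ + w + (s.known.card + (B.length + 1))) := by ring
        linarith

/-- Carry out an augmentation plan, keeping the old matching if it does not work out. -/
noncomputable def tryPlan (w : ℝ) (hw : 0 < w) (s : SearchState n) (N₀ : Finset (Sym2 (Fin n)))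
    (B : List (Fin n)) : QueryTree (VertexPair n) (SearchState n) :=
  (attachNew w hw B ⟨s.known, s.edges, s.dead, N₀⟩).bind fun s' =>
    .ret (if s.matching.card < s'.matching.card then s'
      else ⟨s'.known, s'.edges, s'.dead, s.matching⟩)

/-- The progress measure is |dead| + |matching|. A completed plan gains an edge; a failed one gains
a dead vertex, and falling back on the old matching prevents any loss. -/
theorem tryPlan_spec (w : ℝ) (hw : 0 < w) (U : Finset (Fin n)) (s : SearchState n)
    (hs : s.Valid G U) (N₀ : Finset (Sym2 (Fin n))) (B : List (Fin n))
    (hP : IsAugmentationPlan U s.dead s.edges s.matching N₀ B) :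
    ((tryPlan w hw s N₀ B).eval (adjBit G)).Valid G U ∧
    ((tryPlan w hw s N₀ B).eval (adjBit G)).known.card ≤ s.known.card + 2 ∧
    s.dead.card + s.matching.card + 1 ≤ ((tryPlan w hw s N₀ B).eval (adjBit G)).dead.card +
      ((tryPlan w hw s N₀ B).eval (adjBit G)).matching.card ∧
    (tryPlan w hw s N₀ B).cost (adjBit G) ≤ 2 * (n * w⁻¹ + w + (s.known.card + 2)) := by
  have hw' : 0 < w⁻¹ := inv_pos.2 hw
  obtain ⟨hsub, hdis, hmem, hnd, hcard, hlen⟩ := hP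
  have hN₀ : IsEdgeMatching G N₀ := ⟨fun e he => by
    have := hsub he
    rw [hs.edges_eq, mem_edgesWithin] at this
    exact this.1, hdis⟩
  obtain ⟨h1, h2, h3, h4, h5⟩ := attachNew_spec w hw U B ⟨s.known, s.edges, s.dead, N₀⟩
    ⟨hs.subset_known, hs.edges_eq, hs.dead_subset, hs.not_adj, hN₀, hsub⟩ hmem hnd
  simp only at h2 h3 h4 h5
  have hcost : (tryPlan w hw s N₀ B).cost (adjBit G) ≤
      2 * (n * w⁻¹ + w + (s.known.card + 2)) := by
    rw [tryPlan, QueryTree.cost_bind, QueryTree.cost_ret, add_zero]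
    have hB : (B.length : ℝ) ≤ 2 := by exact_mod_cast hlen
    refine h5.trans ?_
    gcongr
  have heval : (tryPlan w hw s N₀ B).eval (adjBit G) =
      if s.matching.card <
          ((attachNew w hw B ⟨s.known, s.edges, s.dead, N₀⟩).eval (adjBit G)).matching.card
        then (attachNew w hw B ⟨s.known, s.edges, s.dead, N₀⟩).eval (adjBit G)
      else ⟨((attachNew w hw B ⟨s.known, s.edges, s.dead, N₀⟩).eval (adjBit G)).known,
        ((attachNew w hw B ⟨s.known, s.edges, s.dead, N₀⟩).eval (adjBit G)).edges,
        ((attachNew w hw B ⟨s.known, s.edges, s.dead, N₀⟩).eval (adjBit G)).dead,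
        s.matching⟩ := by
    rw [tryPlan, QueryTree.eval_bind, QueryTree.eval_ret]
  rw [heval]
  generalize (attachNew w hw B ⟨s.known, s.edges, s.dead, N₀⟩).eval (adjBit G) = s' at *
  split_ifs with hlt
  · exact ⟨h1, by omega, by omega, hcost⟩
  · refine ⟨⟨h1.subset_known, h1.edges_eq, h1.dead_subset, h1.not_adj, hs.isEdgeMatching, ?_⟩,
      by simp only; omega, by simp only; omega, hcost⟩
    have := hs.matching_subset
    rw [hs.edges_eq] at this
    change s.matching ⊆ s'.edges
    rw [h1.edges_eq]
    exact this.trans (edgesWithin_mono h2)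

open Classical in
/-- Carry out augmentation plans, for at most `r` rounds, as long as there are any. -/
noncomputable def improveMatching (U : Finset (Fin n)) (w : ℝ) (hw : 0 < w) :
    ℕ → SearchState n → QueryTree (VertexPair n) (SearchState n)
  | 0, s => .ret s
  | r + 1, s =>
    if h : ∃ P : Finset (Sym2 (Fin n)) × List (Fin n),
        IsAugmentationPlan U s.dead s.edges s.matching P.1 P.2 then
      (tryPlan w hw s h.choose.1 h.choose.2).bind (improveMatching U w hw r)
    else .ret s

theorem improveMatching_spec (U : Finset (Fin n)) (w : ℝ) (hw : 0 < w) (r c : ℕ)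
    (s : SearchState n) (hs : s.Valid G U) (hc : s.known.card + 2 * r ≤ c) :
    ((improveMatching U w hw r s).eval (adjBit G)).Valid G U ∧
    ((¬ ∃ P : Finset (Sym2 (Fin n)) × List (Fin n), IsAugmentationPlan U
      ((improveMatching U w hw r s).eval (adjBit G)).dead
      ((improveMatching U w hw r s).eval (adjBit G)).edges
      ((improveMatching U w hw r s).eval (adjBit G)).matching P.1 P.2) ∨
    s.dead.card + s.matching.card + r ≤ ((improveMatching U w hw r s).eval (adjBit G)).dead.card +
      ((improveMatching U w hw r s).eval (adjBit G)).matching.card) ∧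
    (improveMatching U w hw r s).cost (adjBit G) ≤ r * (2 * (n * w⁻¹ + w + c)) := by
  have hw' : 0 < w⁻¹ := inv_pos.2 hw
  induction r generalizing s with
  | zero => exact ⟨hs, Or.inr (by simp [improveMatching]), by simp [improveMatching]⟩
  | succ r ih =>
    by_cases h : ∃ P : Finset (Sym2 (Fin n)) × List (Fin n),
        IsAugmentationPlan U s.dead s.edges s.matching P.1 P.2
    · rw [improveMatching, dif_pos h, QueryTree.eval_bind, QueryTree.cost_bind]
      obtain ⟨h1, h2, h3, h4⟩ := tryPlan_spec w hw U s hs _ _ h.choose_spec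
      obtain ⟨g1, g2, g3⟩ := ih _ h1 (by omega)
      refine ⟨g1, g2.imp id fun g => by omega, ?_⟩
      have hK : (s.known.card : ℝ) + 2 ≤ c := by
        have : s.known.card + 2 ≤ c := by omega
        exact_mod_cast this
      push_cast
      linarith
    · rw [improveMatching, dif_neg h]
      refine ⟨hs, Or.inl h, ?_⟩
      rw [QueryTree.cost_ret]
      positivity

/-- The whole procedure for the `k`-matching problem. -/
noncomputable def matchingProcedure (n k : ℕ) (w w' : ℝ) (hw : 0 < w) (hw' : 0 < w') :
    QueryTree (VertexPair n) (Option (Finset (Sym2 (Fin n)))) :=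
  (greedyMatching k w hw Finset.univ.toList ∅).bind fun M =>
    if k ≤ M.card then .ret (some M) else
      (queryAll (newPairs ∅ (coveredVertices M)) (edgesWithin ⊥ ∅)).bind fun H =>
        (improveMatching (coveredVertices M) w' hw' (2 * k) ⟨coveredVertices M, H, ∅, M⟩).bind
          fun s => .ret (if k ≤ s.matching.card then some s.matching else none)

theorem edgesWithin_empty (G : SimpleGraph (Fin n)) : edgesWithin G ∅ = ∅ := by
  refine Finset.eq_empty_of_forall_notMem fun e he => ?_
  exact Finset.notMem_empty _ ((mem_edgesWithin.1 he).2 _ (Sym2.out_fst_mem e))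

theorem matchingProcedure_spec (n k : ℕ) (w w' : ℝ) (hw : 0 < w) (hw' : 0 < w')
    (G : SimpleGraph (Fin n)) :
    IsCorrectMatchingAnswer G k ((matchingProcedure n k w w' hw hw').eval (adjBit G)) ∧
    (matchingProcedure n k w w' hw hw').cost (adjBit G) ≤
      (n ^ 2 * w⁻¹ + k * w) + (4 * k ^ 2 + 2 * k * (2 * (n * w'⁻¹ + w' + 6 * k))) := by
  obtain ⟨h1, -, h3, h4, h5⟩ := greedyMatching_spec k w hw (Finset.univ.toList) ∅
    (isEdgeMatching_empty (G := G)) (Nat.zero_le k)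
  rw [matchingProcedure]
  simp only [QueryTree.eval_bind, QueryTree.cost_bind]
  set M := (greedyMatching k w hw Finset.univ.toList ∅).eval (adjBit G)
  have hi : 0 < w⁻¹ := inv_pos.2 hw
  have hi' : 0 < w'⁻¹ := inv_pos.2 hw'
  have hgreedy : (greedyMatching k w hw Finset.univ.toList ∅).cost (adjBit G) ≤
      n ^ 2 * w⁻¹ + k * w := by
    refine h5.trans ?_
    have hlen : ((Finset.univ : Finset (VertexPair n)).toList.length : ℝ) ≤ n ^ 2 := by
      rw [Finset.length_toList]
      have h : (Finset.univ : Finset (VertexPair n)).card ≤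
          (Finset.univ : Finset (Fin n × Fin n)).card := by
        refine le_trans (Finset.card_le_card_of_injOn (t := Finset.univ.image fun p => s(p.1, p.2))
          Subtype.val ?_ Subtype.val_injective.injOn) Finset.card_image_le
        rintro ⟨e, he⟩ -
        induction e with | _ a b
        exact Finset.mem_image.2 ⟨(a, b), Finset.mem_univ _, rfl⟩
      have h' : (Finset.univ : Finset (Fin n × Fin n)).card = n ^ 2 := by simp [sq]
      rw [h'] at h
      exact_mod_cast h
    rw [Finset.card_empty, Nat.cast_zero, sub_zero]
    gcongr
  split_ifs with hk
  · refine ⟨⟨h1, hk⟩, ?_⟩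
    simp only [QueryTree.cost_ret, add_zero]
    refine hgreedy.trans (le_add_of_nonneg_right ?_)
    positivity
  · simp only [QueryTree.eval_bind, QueryTree.cost_bind, QueryTree.eval_ret, QueryTree.cost_ret]
    -- The procedure must not depend on `G`, so its empty initial edge set is written with `⊥`.
    rw [(edgesWithin_empty ⊥).trans (edgesWithin_empty G).symm, eval_queryAll_newPairs (Finset.empty_subset _),
      cost_queryAll]
    set U := coveredVertices M
    have hUcard : U.card = 2 * M.card := h1.card_coveredVertices
    -- `6 * k` bounds the known vertices: at most 2k in `U`, plus at most two in each of 2k rounds.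
    obtain ⟨g1, g2, g3⟩ := improveMatching_spec (G := G) U w' hw' (2 * k) (6 * k)
      ⟨U, edgesWithin G U, ∅, M⟩ ⟨subset_rfl, rfl, Finset.empty_subset _, by simp, h1,
        fun e he => mem_edgesWithin.2
          ⟨h1.1 e he, fun v hv => mem_coveredVertices.2 ⟨e, he, hv⟩⟩⟩ (by simp only; omega)
    set s := (improveMatching U w' hw' (2 * k) ⟨U, edgesWithin G U, ∅, M⟩).eval (adjBit G)
    constructor
    · split_ifs with hks
      · exact ⟨g1.isEdgeMatching, hks⟩
      · rintro ⟨M', hM', hkM'⟩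
        rcases g2 with g2 | g2
        · obtain ⟨N₀, B, hP⟩ := exists_isAugmentationPlan g1.isEdgeMatching
            g1.coveredVertices_subset (fun e he => by
              obtain ⟨v, hv, hvM⟩ := h4 (by omega) ⟨e, G.not_isDiag_of_mem_edgeSet he⟩
                (Finset.mem_toList.2 (Finset.mem_univ _)) he
              exact ⟨v, hvM, hv⟩) g1.subset_known g1.not_adj hM' (by omega)
          rw [← g1.edges_eq] at hP
          exact g2 ⟨(N₀, B), hP⟩
        -- If all rounds were used, then |dead| ≤ |U| = 2|M| leaves a final matching of at least 2k
        -- - |M| > k edges, a contradiction.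
        · have := Finset.card_le_card g1.dead_subset
          simp only [Finset.card_empty] at g2
          omega
    · have hlen : ((newPairs ∅ U).length : ℝ) ≤ 4 * k ^ 2 := by
        have h := length_newPairs_empty_le U
        have h' : U.card ≤ 2 * k := by omega
        have h'' : (newPairs ∅ U).length ≤ 4 * k ^ 2 := h.trans (by nlinarith)
        exact_mod_cast h''
      push_cast at g3
      linarith

end Procedure

/-! ### The degenerate case and the query bound -/

theorem exists_algorithm_zero_queries {n : ℕ} (e₀ : VertexPair n) {α : Type} (a : α) :
    ∃ A : QuantumQueryAlgorithm n α, A.queries = 0 ∧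
      ∀ (G : SimpleGraph (Fin n)) (S : Set α), a ∈ S → 2 / 3 ≤ A.outputProb G S := by
  classical
  obtain ⟨A, hA, hA'⟩ := exists_algorithm_of_states (Work := Unit) (e₀, false, ()) (fun _ => a) 0
    (fun _ _ => Pi.single (e₀, false, ()) 1) (Pi.single (e₀, false, ()) 1)
    (by simp [Pi.single_apply]) (by simp)
  refine ⟨A, hA, fun G S ha => hA' G S (Pi.single (e₀, false, ()) 1) (fun _ h => absurd ha h) ?_
    ?_ ?_⟩ <;> simp [Pi.single_apply]

/-- If k ≤ n then k√n = √k·√(kn) ≤ √k·n; otherwise √n ≤ k. -/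
theorem nat_mul_sqrt_le (n k : ℕ) :
    (k : ℝ) * Real.sqrt n ≤ Real.sqrt k * n + (k : ℝ) ^ 2 := by
  have hk : (0 : ℝ) ≤ k := Nat.cast_nonneg k
  have hn : (0 : ℝ) ≤ n := Nat.cast_nonneg n
  rcases le_total (k : ℝ) n with h | h
  · have h1 : (k : ℝ) * Real.sqrt n ≤ Real.sqrt k * n := by
      calc (k : ℝ) * Real.sqrt n = Real.sqrt k * (Real.sqrt k * Real.sqrt n) := by
            rw [← mul_assoc, Real.mul_self_sqrt hk]
        _ ≤ Real.sqrt k * (Real.sqrt n * Real.sqrt n) := by gcongr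
        _ = Real.sqrt k * n := by rw [Real.mul_self_sqrt hn]
    nlinarith
  · have h1 : Real.sqrt n ≤ k := by
      rw [Real.sqrt_le_left hk]
      have : (k : ℝ) ≤ (k : ℝ) ^ 2 := by exact_mod_cast Nat.le_self_pow two_ne_zero k
      linarith
    have h2 : 0 ≤ Real.sqrt k * n := by positivity
    nlinarith

/-- The weight n/√k balances n² `false` answers against k `true` ones, and √n balances n against
one. The total 2√k·n + 28k² + 8k√n is at most 10√k·n + 36k². -/
theorem matchingProcedure_cost_le {n k : ℕ} (hn : 0 < n) (hk : 0 < k)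
    (hw : 0 < (n : ℝ) / Real.sqrt k) (hw' : 0 < Real.sqrt n) (G : SimpleGraph (Fin n)) :
    (matchingProcedure n k (n / Real.sqrt k) (Real.sqrt n) hw hw').cost (adjBit G) ≤
      36 * (Real.sqrt k * n + (k : ℝ) ^ 2) := by
  refine (matchingProcedure_spec n k _ _ hw hw' G).2.trans ?_
  have hn' : (0 : ℝ) < n := by exact_mod_cast hn
  have hk' : (0 : ℝ) < k := by exact_mod_cast hk
  have hs : 0 < Real.sqrt k := Real.sqrt_pos.2 hk'
  have h1 : (n : ℝ) ^ 2 * (n / Real.sqrt k)⁻¹ = Real.sqrt k * n := by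
    field_simp
  have h2 : (k : ℝ) * (n / Real.sqrt k) = Real.sqrt k * n := by
    rw [mul_div_left_comm, Real.div_sqrt, mul_comm]
  have h3 : (n : ℝ) * (Real.sqrt n)⁻¹ = Real.sqrt n := by
    rw [← div_eq_mul_inv, Real.div_sqrt]
  rw [h1, h2, h3]
  have h4 := nat_mul_sqrt_le n k
  have h5 : 0 ≤ Real.sqrt k * n := by positivity
  nlinarith

theorem theorem5 :
    ∃ C : ℝ, 0 < C ∧ ∀ n k : ℕ, 2 ≤ n →
      ∃ A : QuantumQueryAlgorithm n (Option (Finset (Sym2 (Fin n)))),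
        (A.queries : ℝ) ≤ C * (Real.sqrt (k : ℝ) * (n : ℝ) + (k : ℝ) ^ 2) ∧
        ∀ G : SimpleGraph (Fin n),
          (2 / 3 : ℝ) ≤ A.outputProb G {o | IsCorrectMatchingAnswer G k o} := by
  -- 5184 = 144 · 36, and one more absorbs the ceiling, since the bound is at least 1 when k ≥ 1.
  refine ⟨5185, by norm_num, fun n k hn => ?_⟩
  let e₀ : VertexPair n := ⟨s(⟨0, by omega⟩, ⟨1, by omega⟩), by simp⟩
  rcases Nat.eq_zero_or_pos k with rfl | hk
  -- For k = 0 the bound is zero, so no query is allowed; the empty matching is always correct.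
  · obtain ⟨A, hA, hA'⟩ := exists_algorithm_zero_queries e₀ (some (∅ : Finset (Sym2 (Fin n))))
    exact ⟨A, by simp [hA], fun G => hA' G _ ⟨isEdgeMatching_empty, Nat.zero_le _⟩⟩
  · have hn' : (0 : ℝ) < n := by exact_mod_cast (by omega : 0 < n)
    have hk' : (1 : ℝ) ≤ k := by exact_mod_cast hk
    have hw : 0 < (n : ℝ) / Real.sqrt k := div_pos hn' (Real.sqrt_pos.2 (by linarith))
    have hw' : 0 < Real.sqrt n := Real.sqrt_pos.2 hn'
    set X : ℝ := Real.sqrt k * n + (k : ℝ) ^ 2 with hX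
    have hX1 : 1 ≤ X := by
      have : 0 ≤ Real.sqrt k * n := by positivity
      nlinarith
    obtain ⟨A, hA, hA'⟩ := QueryTree.exists_algorithm e₀
      (matchingProcedure n k (n / Real.sqrt k) (Real.sqrt n) hw hw') ⌈5184 * X⌉₊
      (Nat.ceil_pos.2 (by linarith)) (fun G => by
        have h1 := matchingProcedure_cost_le (by omega) hk hw hw' G
        have h2 := Nat.le_ceil (5184 * X)
        linarith)
    refine ⟨A, ?_, fun G => hA' G _ (matchingProcedure_spec n k _ _ hw hw' G).1⟩
    rw [hA]
    have := (Nat.ceil_lt_add_one (show 0 ≤ 5184 * X by linarith)).le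
    linarith
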